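/- Let $G$ be an infinite connected graph in which every vertex has finite degree, with a fixed root vertex $\mathbf 0$, and let $\Xi$ be a random variable with values in $\{0,1,2,\dots\}$. The frog model $\mathrm{FM}(G,\Xi)$ is defined as follows. To each vertex $x$ attach a simple random walk $(S^x_n)_{n\ge 0}$ on $G$ with $S^x_0=x$ and a lifetime $\Xi^x$ with the same law as $\Xi$, all these walks and lifetimes being independent. For vertices $x,y$ put $$t(x,y)=\min\{n<\Xi^x : S^x_n=y\}\qquad(\min\emptyset=\infty),$$ and let $$T(x)=\inf\{t(x_0,x_1)+\dots+t(x_{m-1},x_m)\},$$ the infimum being over all $m\ge 0$ and all finite sequences of vertices $\mathbf 0=x_0,x_1,\dots,x_m=x$ (so $T(\mathbf 0)=0$). The particle of $x$ is activated at time $T(x)$ (never, if $T(x)=\infty$) and then occupies the vertex $S^x_n$ at time $T(x)+n$ for $0\le n<\Xi^x$. The root is hit infinitely often if there are infinitely many pairs $(x,n)$ with $T(x)<\infty$, $n<\Xi^x$ and $S^x_n=\mathbf 0$. The model is recurrent if the root is hit infinitely often with positive probability, and transient otherwise. Let $\mathbb Z^d$ be the graph on the integer lattice in which $x,y$ are neighbours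 iff $\sum_i|x^{(i)}-y^{(i)}|=1$, and let $\mathbb T_d$ ($d\ge3$) be the homogeneous tree, i.e. the tree in which every vertex has degree $d$. **Theorem.** Suppose that one of the following alternatives holds: - $G=\mathbb Z$ and $\mathbf E\sqrt{\Xi}<\infty$; - $G=\mathbb Z^2$ and $\mathbf E\,\dfrac{\Xi}{\log(\Xi\vee 2)}<\infty$; - $G=\mathbb T_d$ or $G=\mathbb Z^d$ with $d\ge 3$, and $\mathbf E\,\Xi<\infty$. Then $\mathrm{FM}(G,\Xi)$ is transient. -/

import Mathlib

open MeasureTheory ProbabilityTheory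
open scoped ENNReal

universe u w

/-- The graph `ℤ^d`: two sites are neighbours iff their `ℓ¹`-distance is `1`. -/
def latticeGraph (d : ℕ) : SimpleGraph (Fin d → ℤ) where
  Adj x y := ∑ i, |x i - y i| = 1
  symm := ⟨fun x y h => by simpa only [abs_sub_comm] using h⟩
  loopless := ⟨fun x h => by simp at h⟩

theorem latticeGraph_neighborSet_finite (d : ℕ) (x : Fin d → ℤ) :
    ((latticeGraph d).neighborSet x).Finite := by
  refine (Set.finite_Icc (fun i => x i - 1) (fun i => x i + 1)).subset ?_
  intro y hy
  have hy' : ∑ i, |x i - y i| = 1 := hy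
  have key : ∀ i, |x i - y i| ≤ 1 := fun i =>
    hy' ▸ Finset.single_le_sum (f := fun i => |x i - y i|)
      (fun j _ => abs_nonneg _) (Finset.mem_univ i)
  constructor
  · intro i
    have := abs_le.mp (key i)
    show x i - 1 ≤ y i
    omega
  · intro i
    have := abs_le.mp (key i)
    show y i ≤ x i + 1
    omega

noncomputable instance latticeGraph_locallyFinite (d : ℕ) : (latticeGraph d).LocallyFinite :=
  fun x => (latticeGraph_neighborSet_finite d x).fintype

namespace Frog

section Dynamics

variable {V : Type*}

/-- `t(x, y)`: the first time `n < life x` at which the particle that starts from `x` (with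
trajectory `S x` and lifetime `life x`) is at `y`; it is `⊤` if there is no such time. -/
noncomputable def hitTime (S : V → ℕ → V) (life : V → ℕ) (x y : V) : ℕ∞ :=
  ⨅ (n : ℕ) (_ : n < life x ∧ S x n = y), (n : ℕ∞)

/-- `T(x)`: the moment at which the particle sleeping at `x` is activated, i.e. the infimum of
`t(x₀, x₁) + ⋯ + t(x_{m-1}, x_m)` over all finite sequences `o = x₀, x₁, …, x_m = x`.
It is `⊤` if `x` is never visited by active particles. -/
noncomputable def activationTime (S : V → ℕ → V) (life : V → ℕ) (o x : V) : ℕ∞ :=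
  ⨅ (m : ℕ) (p : ℕ → V) (_ : p 0 = o ∧ p m = x),
    ∑ i ∈ Finset.range m, hitTime S life (p i) (p (i + 1))

/-- The visits to the root `o` by active particles: pairs `(x, n)` such that the particle from `x`
is activated at some finite time and, `n` units of time after its activation, is
still alive and is at `o`. -/
def visitsToRoot (S : V → ℕ → V) (life : V → ℕ) (o : V) : Set (V × ℕ) :=
  {q | activationTime S life o q.1 < ⊤ ∧ q.2 < life q.1 ∧ S q.1 q.2 = o}

end Dynamics

section Law

variable {V : Type*} (G : SimpleGraph V) [G.LocallyFinite]

open Classical in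
/-- One-step transition probabilities of the simple random walk on `G`. -/
noncomputable def stepProb (x y : V) : ℝ≥0∞ :=
  if G.Adj x y then (G.degree x : ℝ≥0∞)⁻¹ else 0

open Classical in
/-- `X` is a discrete time simple random walk on `G` started from `x`
(given by its finite-dimensional distributions). -/
structure IsSimpleRandomWalk [MeasurableSpace V] {Ω : Type*} [MeasurableSpace Ω]
    (P : Measure Ω) (x : V) (X : ℕ → Ω → V) : Prop where
  measurable : ∀ n, Measurable (X n)
  law : ∀ (n : ℕ) (p : ℕ → V),
    P {ω | ∀ i ≤ n, X i ω = p i} =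
      (if p 0 = x then 1 else 0) * ∏ i ∈ Finset.range n, stepProb G (p i) (p (i + 1))

/-- The random input of the frog model on `G` with one particle per site and lifetime law `μ`:
`S x` is the trajectory and `life x` the lifetime of the particle originating from `x`.
The trajectories are independent simple random walks, the lifetimes are i.i.d. with law `μ`, and
the trajectories are independent of the lifetimes. -/
structure IsModel [MeasurableSpace V] (μ : Measure ℕ) {Ω : Type*} [MeasurableSpace Ω]
    (P : Measure Ω) (S : V → ℕ → Ω → V) (life : V → Ω → ℕ) : Prop where
  walk : ∀ x, IsSimpleRandomWalk G P x (S x)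
  life_measurable : ∀ x, Measurable (life x)
  life_law : ∀ x, P.map (life x) = μ
  walk_indep : iIndepFun (fun x ω n => S x n ω) P
  life_indep : iIndepFun life P
  indep : IndepFun (fun ω x n => S x n ω) (fun ω x => life x ω) P

/-- Recurrence: with positive probability the root is hit infinitely often. -/
def Recurrent {Ω : Type*} [MeasurableSpace Ω] (P : Measure Ω)
    (S : V → ℕ → Ω → V) (life : V → Ω → ℕ) (o : V) : Prop :=
  0 < P {ω | (visitsToRoot (fun x n => S x n ω) (fun x => life x ω) o).Infinite}

/-- The frog model on `G` with root `o`, one particle per site and lifetime law `μ`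
is transient, i.e. not recurrent, whatever the probability space it is realized on. -/
def Transient {V : Type u} (G : SimpleGraph V) [G.LocallyFinite] [MeasurableSpace V]
    (o : V) (μ : Measure ℕ) : Prop :=
  ∀ (Ω : Type w) [MeasurableSpace Ω] (P : Measure Ω) [IsProbabilityMeasure P]
    (S : V → ℕ → Ω → V) (life : V → Ω → ℕ),
    IsModel G μ P S life → ¬ Recurrent P S life o

end Law

end Frog

/-! Activation plays no role: a visit to the root `o` by the particle of `x` forces the walk from
`x` to hit `o` within its lifetime. If the expected number of such `x` is finite, Borel–Cantelli
leaves finitely many, each making finitely many visits.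

That expectation is `E h(Ξ)`, where `h(k)` is the sum over `x` of the probability that the walk from
`x` hits `o` before time `k`. After hitting `o`, the walk spends there on average `g(m)`, the sum of
its return probabilities at times below `m`, during the next `m` units of time. On a regular graph
the step kernel is symmetric, so the expected occupation of `o` summed over all starting points is
at most one per time unit. Hence `h(k) * g(m) ≤ k + m` (`tsum_hitProb_mul_le`).

Taking `m = 1` gives `h(k) ≤ k + 1`, enough when `E Ξ < ∞`. In dimensions 1 and 2, take `m = k` and
bound `g(k)` below by a multiple of `√k` or `log k`: by Chebyshev the walk at time `n` has half its
mass in a box of side of order `√n`, and Cauchy–Schwarz turns this into a return bound of order `n ^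
(-d / 2)` at time `2 * n`. -/

namespace Frog

/-! ### Transition and hitting probabilities -/

section Kernel

variable {V : Type*} (G : SimpleGraph V) [G.LocallyFinite]

theorem tsum_stepProb_mul (x : V) (g : V → ℝ≥0∞) :
    ∑' z, stepProb G x z * g z = (G.degree x : ℝ≥0∞)⁻¹ * ∑ z ∈ G.neighborFinset x, g z := by
  rw [tsum_eq_sum (s := G.neighborFinset x), Finset.mul_sum]
  · refine Finset.sum_congr rfl fun z hz => ?_
    rw [SimpleGraph.mem_neighborFinset] at hz
    simp [stepProb, hz]
  · intro z hz
    rw [SimpleGraph.mem_neighborFinset] at hz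
    simp [stepProb, hz]

variable {G} in
theorem stepProb_symm {D : ℕ} (hG : G.IsRegularOfDegree D) (x y : V) :
    stepProb G x y = stepProb G y x := by
  classical
  unfold stepProb
  rw [hG.degree_eq, hG.degree_eq]
  exact if_congr (G.adj_comm x y) rfl rfl

theorem tsum_stepProb_le_one (x : V) : ∑' z, stepProb G x z ≤ 1 := by
  have h := tsum_stepProb_mul G x 1
  simp only [Pi.one_apply, mul_one, Finset.sum_const, SimpleGraph.card_neighborFinset_eq_degree,
    nsmul_eq_mul] at h
  rw [h]
  exact ENNReal.inv_mul_le_one _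

variable {G} in
theorem tsum_stepProb {x : V} (hx : G.degree x ≠ 0) : ∑' z, stepProb G x z = 1 := by
  have h := tsum_stepProb_mul G x 1
  simp only [Pi.one_apply, mul_one, Finset.sum_const, SimpleGraph.card_neighborFinset_eq_degree,
    nsmul_eq_mul] at h
  rw [h]
  exact ENNReal.inv_mul_cancel (by exact_mod_cast hx) (ENNReal.natCast_ne_top _)

open Classical in
/-- The `n`-step transition probabilities of the simple random walk on `G`. -/
noncomputable def transProb : ℕ → V → V → ℝ≥0∞
  | 0, x, y => if x = y then 1 else 0
  | n + 1, x, y => ∑' z, stepProb G x z * transProb n z y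

open Classical in
/-- The probability that the simple random walk started from `x` is at `o` at some time
before `k`. -/
noncomputable def hitProb (o : V) : ℕ → V → ℝ≥0∞
  | 0, _ => 0
  | k + 1, x => if x = o then 1 else ∑' z, stepProb G x z * hitProb o k z

theorem hitProb_le_one (o : V) (k : ℕ) (x : V) : hitProb G o k x ≤ 1 := by
  induction k generalizing x with
  | zero => simp [hitProb]
  | succ k ih =>
    rw [hitProb]
    split_ifs
    · exact le_rfl
    · refine le_trans (ENNReal.tsum_le_tsum fun z => ?_) (tsum_stepProb_le_one G x)
      exact mul_le_of_le_one_right' (ih z)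

/-- A walk that hits `o` before time `k` spends there, in the next `m` units of time, as long on
average as a walk started from `o`. -/
theorem hitProb_mul_sum_transProb_le (o : V) (m k : ℕ) (x : V) :
    hitProb G o k x * ∑ n ∈ Finset.range m, transProb G n o o ≤
      ∑ n ∈ Finset.range (k + m), transProb G n x o := by
  induction k generalizing x with
  | zero => simp [hitProb]
  | succ k ih =>
    by_cases hx : x = o
    · subst hx
      calc _ ≤ 1 * ∑ n ∈ Finset.range m, transProb G n x x := by
            gcongr; exact hitProb_le_one G x _ x
        _ ≤ _ := by
            rw [one_mul]
            exact Finset.sum_le_sum_of_subset (Finset.range_mono (by omega))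
    · rw [hitProb, if_neg hx, ← ENNReal.tsum_mul_right]
      calc _ ≤ ∑' z, stepProb G x z * ∑ n ∈ Finset.range (k + m), transProb G n z o := by
            refine ENNReal.tsum_le_tsum fun z => ?_
            rw [mul_assoc]
            gcongr
            exact ih z
        _ = ∑ n ∈ Finset.range (k + m), transProb G (n + 1) x o := by
            simp only [Finset.mul_sum, transProb]
            exact Summable.tsum_finsetSum fun _ _ => ENNReal.summable
        _ ≤ _ := by
            rw [show k + 1 + m = k + m + 1 by omega, Finset.sum_range_succ']
            exact le_self_add

variable {G}

/-- Regularity makes the step kernel symmetric, so its column sums are at most one, like its row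
sums. -/
theorem tsum_transProb_left_le_one {D : ℕ} (hG : G.IsRegularOfDegree D) (n : ℕ) (y : V) :
    ∑' x, transProb G n x y ≤ 1 := by
  induction n with
  | zero => simp [transProb]
  | succ n ih =>
    simp only [transProb]
    rw [ENNReal.tsum_comm]
    refine le_trans (ENNReal.tsum_le_tsum fun z => ?_) ih
    rw [ENNReal.tsum_mul_right]
    refine mul_le_of_le_one_left' ?_
    simp only [stepProb_symm hG _ z]
    exact tsum_stepProb_le_one G z

theorem tsum_transProb {D : ℕ} (hG : G.IsRegularOfDegree D) (hD : D ≠ 0) (n : ℕ) (x : V) :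
    ∑' y, transProb G n x y = 1 := by
  induction n generalizing x with
  | zero => simp [transProb]
  | succ n ih =>
    simp only [transProb]
    rw [ENNReal.tsum_comm]
    simp only [ENNReal.tsum_mul_left, ih, mul_one]
    exact tsum_stepProb (by rwa [hG.degree_eq])

theorem tsum_hitProb_mul_le {D : ℕ} (hG : G.IsRegularOfDegree D) (o : V) (m k : ℕ) :
    (∑' x, hitProb G o k x) * ∑ n ∈ Finset.range m, transProb G n o o ≤ (k + m : ℕ) := by
  rw [← ENNReal.tsum_mul_right]
  refine le_trans (ENNReal.tsum_le_tsum fun x => hitProb_mul_sum_transProb_le G o m k x) ?_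
  rw [Summable.tsum_finsetSum fun _ _ => ENNReal.summable]
  refine le_trans (Finset.sum_le_sum fun n _ => tsum_transProb_left_le_one hG n o) ?_
  simp

theorem transProb_add (m n : ℕ) (x y : V) :
    transProb G (m + n) x y = ∑' z, transProb G m x z * transProb G n z y := by
  induction m generalizing x with
  | zero =>
    rw [zero_add, tsum_eq_single x]
    · simp [transProb]
    · intro z hz
      simp [transProb, hz.symm]
  | succ m ih =>
    rw [show m + 1 + n = m + n + 1 by omega, transProb]
    simp only [ih, transProb, ← ENNReal.tsum_mul_left, ← ENNReal.tsum_mul_right]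
    rw [ENNReal.tsum_comm]
    simp only [mul_assoc]

theorem transProb_one (x y : V) : transProb G 1 x y = stepProb G x y := by
  rw [transProb, tsum_eq_single y]
  · simp [transProb]
  · intro z hz
    simp [transProb, hz]

theorem transProb_symm {D : ℕ} (hG : G.IsRegularOfDegree D) (n : ℕ) (x y : V) :
    transProb G n x y = transProb G n y x := by
  induction n generalizing x y with
  | zero =>
    classical
    unfold transProb
    exact if_congr eq_comm rfl rfl
  | succ n ih =>
    rw [transProb_add n 1 x y, transProb]
    refine tsum_congr fun z => ?_
    rw [transProb_one, stepProb_symm hG z y, ih x z, mul_comm]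

/-- The return probability is bounded below by the Cauchy–Schwarz inequality on a set that
carries half of the mass of the walk. -/
theorem inv_le_transProb_self {D : ℕ} (hG : G.IsRegularOfDegree D) (n : ℕ) (o : V)
    (B : Finset V) (hB : (2 : ℝ≥0∞)⁻¹ ≤ ∑ y ∈ B, transProb G n o y) :
    ENNReal.ofReal (1 / (4 * B.card)) ≤ transProb G (n + n) o o := by
  have hle : ∀ y, transProb G n o y ≤ 1 := fun y => by
    rw [transProb_symm hG]
    exact (ENNReal.le_tsum (f := fun y => transProb G n y o) y).trans
      (tsum_transProb_left_le_one hG n o)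
  have hfin : ∀ y, transProb G n o y ≠ ∞ := fun y => ne_top_of_le_ne_top ENNReal.one_ne_top (hle y)
  have h1 : (1 / 2 : ℝ) ≤ ∑ y ∈ B, (transProb G n o y).toReal := by
    rw [← ENNReal.toReal_sum fun y _ => hfin y]
    have := ENNReal.toReal_mono (ENNReal.sum_ne_top.2 fun y _ => hfin y) hB
    simpa using this
  have h2 := sq_sum_le_card_mul_sum_sq (s := B) (f := fun y => (transProb G n o y).toReal)
  have h3 : (1 / (4 * B.card) : ℝ) ≤ ∑ y ∈ B, (transProb G n o y).toReal ^ 2 := by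
    rcases (Nat.cast_nonneg (α := ℝ) B.card).eq_or_lt with h0 | h0
    -- For empty `B` the left side is `1 / 0 = 0`.
    · rw [← h0]
      simpa using Finset.sum_nonneg fun y _ => sq_nonneg (transProb G n o y).toReal
    · rw [div_le_iff₀ (by positivity)]
      nlinarith
  calc _ ≤ ENNReal.ofReal (∑ y ∈ B, (transProb G n o y).toReal ^ 2) := ENNReal.ofReal_le_ofReal h3
    _ = ∑ y ∈ B, transProb G n o y * transProb G n y o := by
        rw [ENNReal.ofReal_sum_of_nonneg fun y _ => sq_nonneg _]
        refine Finset.sum_congr rfl fun y _ => ?_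
        rw [ENNReal.ofReal_pow ENNReal.toReal_nonneg, ENNReal.ofReal_toReal (hfin y), sq,
          transProb_symm hG n y o]
    _ ≤ _ := by
        rw [transProb_add]
        exact ENNReal.sum_le_tsum B

end Kernel

/-! ### From the walks to transience -/

section Model

variable {V : Type*} {G : SimpleGraph V} [G.LocallyFinite] [MeasurableSpace V]
  {Ω : Type*} [MeasurableSpace Ω] {P : Measure Ω}

/-- The Markov property, drawn from path probabilities alone: prescribing the past as a full path
`p` lets the induction extend it by one step at a time. A union bound over that step suffices. -/
theorem IsSimpleRandomWalk.measure_path_inter_hit_le [Countable V] {x : V} {X : ℕ → Ω → V}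
    (hX : IsSimpleRandomWalk G P x X) (o : V) (k n : ℕ) (p : ℕ → V) :
    P {ω | (∀ i ≤ n, X i ω = p i) ∧ ∃ i, n ≤ i ∧ i < n + k ∧ X i ω = o} ≤
      P {ω | ∀ i ≤ n, X i ω = p i} * hitProb G o k (p n) := by
  classical
  induction k generalizing n p with
  | zero =>
    have : {ω | (∀ i ≤ n, X i ω = p i) ∧ ∃ i, n ≤ i ∧ i < n + 0 ∧ X i ω = o} = ∅ := by
      ext ω
      simp only [Set.mem_ofPred_eq, Set.mem_empty_iff_false, iff_false]
      rintro ⟨-, i, h1, h2, -⟩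
      omega
    rw [this]
    simp
  | succ k ih =>
    by_cases ho : p n = o
    · rw [hitProb, if_pos ho, mul_one]
      exact measure_mono fun ω hω => hω.1
    rw [hitProb, if_neg ho, ← ENNReal.tsum_mul_left]
    have hext : ∀ z i, i ≤ n → Function.update p (n + 1) z i = p i := fun z i hi =>
      Function.update_of_ne (by omega) _ _
    calc _ ≤ P (⋃ z, {ω | (∀ i ≤ n + 1, X i ω = Function.update p (n + 1) z i) ∧
            ∃ i, n + 1 ≤ i ∧ i < n + 1 + k ∧ X i ω = o}) := by
          refine measure_mono fun ω hω => ?_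
          obtain ⟨h1, i, hi, hik, hio⟩ := hω
          refine Set.mem_iUnion.2 ⟨X (n + 1) ω, fun j hj => ?_, i, ?_, by omega, hio⟩
          · rcases hj.lt_or_eq with hj | rfl
            · rw [hext _ _ (by omega), h1 j (by omega)]
            · simp
          · rcases hi.lt_or_eq with hi | rfl
            · omega
            · exact absurd ((h1 n le_rfl).symm.trans hio) ho
      _ ≤ ∑' z, _ := measure_iUnion_le _
      _ ≤ ∑' z, P {ω | ∀ i ≤ n, X i ω = p i} * (stepProb G (p n) z * hitProb G o k z) := by
          refine ENNReal.tsum_le_tsum fun z => (ih (n + 1) _).trans (le_of_eq ?_)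
          rw [hX.law, hX.law, Finset.prod_range_succ, hext z 0 (by omega), hext z n le_rfl,
            Function.update_self, Finset.prod_congr rfl fun i hi => ?_]
          · ring
          · rw [Finset.mem_range] at hi
            rw [hext z i (by omega), hext z (i + 1) (by omega)]

theorem IsSimpleRandomWalk.measure_hit_le [Countable V] [MeasurableSingletonClass V]
    [IsProbabilityMeasure P]
    {x : V} {X : ℕ → Ω → V} (hX : IsSimpleRandomWalk G P x X) (o : V) (k : ℕ) :
    P {ω | ∃ i < k, X i ω = o} ≤ hitProb G o k x := by
  have h0 : P {ω | ∀ i ≤ 0, X i ω = x} = 1 := by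
    have := hX.law 0 fun _ => x
    simpa using this
  have hae : ∀ᵐ ω ∂P, X 0 ω = x := by
    have hms : {ω | ∀ i ≤ 0, X i ω = x} = {ω | X 0 ω = x} := by simp
    rw [hms] at h0
    exact (mem_ae_iff_prob_eq_one (hX.measurable 0 (measurableSet_singleton x))).2 h0
  calc P {ω | ∃ i < k, X i ω = o}
      ≤ P {ω | (∀ i ≤ 0, X i ω = x) ∧ ∃ i, 0 ≤ i ∧ i < 0 + k ∧ X i ω = o} := by
        refine measure_mono_ae ?_
        filter_upwards [hae] with ω hω h
        obtain ⟨i, hi, hio⟩ := h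
        exact ⟨fun j hj => by rwa [Nat.le_zero.1 hj], i, i.zero_le, by omega, hio⟩
    _ ≤ _ := hX.measure_path_inter_hit_le o k 0 fun _ => x
    _ = _ := by rw [h0, one_mul]

theorem IsModel.measure_hit_before_death_le [Countable V] [MeasurableSingletonClass V]
    [IsProbabilityMeasure P] {μ : Measure ℕ} {S : V → ℕ → Ω → V} {life : V → Ω → ℕ}
    (h : IsModel G μ P S life) (o x : V) :
    P {ω | ∃ n < life x ω, S x n ω = o} ≤ ∫⁻ k, hitProb G o k x ∂μ := by
  have hA : ∀ k : ℕ, MeasurableSet {f : V → ℕ → V | ∃ n < k, f x n = o} := fun k => by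
    have : {f : V → ℕ → V | ∃ n < k, f x n = o} =
        ⋃ n ∈ Set.Iio k, (fun f : V → ℕ → V => f x n) ⁻¹' {o} := by
      ext f; simp
    rw [this]
    exact MeasurableSet.biUnion (Set.to_countable _) fun n _ =>
      (by fun_prop : Measurable fun f : V → ℕ → V => f x n) (measurableSet_singleton o)
  have hL : ∀ k : ℕ, MeasurableSet {l : V → ℕ | l x = k} := fun k =>
    measurableSet_eq_fun (measurable_pi_apply x) measurable_const
  calc _ ≤ P (⋃ k : ℕ, {ω | ∃ n < k, S x n ω = o} ∩ {ω | life x ω = k}) := by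
        refine measure_mono fun ω hω => Set.mem_iUnion.2 ⟨life x ω, hω, rfl⟩
    _ ≤ ∑' k : ℕ, P ({ω | ∃ n < k, S x n ω = o} ∩ {ω | life x ω = k}) := measure_iUnion_le _
    -- Trajectories and lifetimes are independent, so each term factors.
    _ ≤ ∑' k : ℕ, hitProb G o k x * μ {k} := by
        refine ENNReal.tsum_le_tsum fun k => ?_
        have hi := h.indep.measure_inter_preimage_eq_mul _ _ (hA k) (hL k)
        have hl : P {ω | life x ω = k} = μ {k} := by
          rw [← h.life_law x, Measure.map_apply (h.life_measurable x) (measurableSet_singleton k)]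
          rfl
        simp only [Set.preimage_ofPred_eq] at hi
        rw [hi, hl]
        gcongr
        exact (h.walk x).measure_hit_le o k
    _ = _ := (lintegral_countable' _).symm

/-- If the expected number of particles that hit the root during their lives is finite, then the
model is transient. -/
theorem transient_of_lintegral_ne_top [Countable V] [MeasurableSingletonClass V] {μ : Measure ℕ}
    (o : V) (hμ : ∫⁻ k, ∑' x, hitProb G o k x ∂μ ≠ ∞) : Transient.{_, w} G o μ := by
  intro Ω _ P _ S life h hrec
  refine hrec.ne' ?_
  have hsum : ∑' x, P {ω | ∃ n < life x ω, S x n ω = o} ≠ ∞ := by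
    refine ne_top_of_le_ne_top hμ ?_
    rw [lintegral_tsum fun x => (measurable_of_countable _).aemeasurable]
    exact ENNReal.tsum_le_tsum fun x => h.measure_hit_before_death_le o x
  -- Borel–Cantelli; no independence between particles is needed.
  have hfin := ae_finite_setOfPred_mem hsum
  refine measure_mono_null (fun ω hω => ?_) hfin
  intro hf
  refine hω ?_
  refine (hf.biUnion fun x _ =>
    (Set.finite_singleton x).prod (Set.finite_Iio (life x ω))).subset ?_
  rintro ⟨x, n⟩ ⟨-, hn, hS⟩
  exact Set.mem_biUnion (show x ∈ {x | _} from ⟨n, hn, hS⟩) ⟨rfl, hn⟩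

theorem transient_of_tsum_hitProb_le [Countable V] [MeasurableSingletonClass V] {μ : Measure ℕ}
    (o : V) {C : ℝ≥0∞} (hC : C ≠ ∞) {f : ℕ → ℝ≥0∞}
    (hf : ∀ k, ∑' x, hitProb G o k x ≤ C * f k) (hμ : ∫⁻ k, f k ∂μ < ∞) :
    Transient.{_, w} G o μ := by
  refine transient_of_lintegral_ne_top o (ne_top_of_le_ne_top ?_ (lintegral_mono hf))
  rw [lintegral_const_mul _ (measurable_of_countable _)]
  exact ENNReal.mul_ne_top hC hμ.ne

theorem transient_of_isRegularOfDegree [Countable V] [MeasurableSingletonClass V]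
    {μ : Measure ℕ} {D : ℕ} (hG : G.IsRegularOfDegree D) (o : V)
    (hμ : ∫⁻ k, (k : ℝ≥0∞) ∂μ < ∞) : Transient.{_, w} G o μ := by
  refine transient_of_tsum_hitProb_le o (C := 2) (by simp) (fun k => ?_) hμ
  rcases k.eq_zero_or_pos with rfl | hk
  · simp [hitProb]
  -- With `m = 1` the return sum is the time-zero term `1`, leaving `k + 1 ≤ 2 * k`.
  · have := tsum_hitProb_mul_le hG o 1 k
    simp only [Finset.range_one, Finset.sum_singleton, transProb, if_true, mul_one] at this
    refine this.trans ?_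
    exact_mod_cast (by omega : k + 1 ≤ 2 * k)

end Model

/-- Local finiteness leaves finitely many vertices joined to `o` by a walk of each given length. The
tree case needs this to sum over vertices. -/
theorem countable_of_preconnected {V : Type*} (G : SimpleGraph V) [G.LocallyFinite]
    (hG : G.Preconnected) (o : V) : Countable V := by
  have hball : ∀ n, {x | ∃ p : G.Walk x o, p.length = n}.Finite := by
    intro n
    induction n with
    | zero =>
      refine (Set.finite_singleton o).subset ?_
      rintro x ⟨p, hp⟩
      exact p.eq_of_length_eq_zero hp
    | succ n ih =>
      refine (ih.biUnion fun x _ => (G.neighborSet x).toFinite).subset ?_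
      rintro x ⟨p, hp⟩
      cases p with
      | nil => simp at hp
      | cons hadj q => exact Set.mem_biUnion ⟨q, by simpa using hp⟩ hadj.symm
  refine Set.countable_univ_iff.1 ((Set.countable_iUnion fun n => (hball n).countable).mono ?_)
  intro x _
  obtain ⟨p⟩ := hG x o
  exact Set.mem_iUnion.2 ⟨p.length, p, rfl⟩

/-! ### Return probabilities on the lattice -/

section Lattice

variable {d : ℕ}

theorem latticeGraph_adj {x y : Fin d → ℤ} :
    (latticeGraph d).Adj x y ↔ ∑ i, |x i - y i| = 1 := Iff.rfl

/-- Translations are automorphisms of the lattice. -/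
def latticeGraphTranslate (v : Fin d → ℤ) : latticeGraph d ≃g latticeGraph d where
  toEquiv := Equiv.addRight v
  map_rel_iff' := by simp [latticeGraph_adj]

theorem latticeGraph_isRegularOfDegree (d : ℕ) :
    (latticeGraph d).IsRegularOfDegree ((latticeGraph d).degree 0) := fun x => by
  have := (latticeGraphTranslate x).degree_eq 0
  rwa [show latticeGraphTranslate x 0 = x from zero_add x] at this

theorem latticeGraph_degree_ne_zero (hd : 0 < d) (x : Fin d → ℤ) :
    (latticeGraph d).degree x ≠ 0 := by
  rw [latticeGraph_isRegularOfDegree d x, ← Nat.pos_iff_ne_zero,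
    SimpleGraph.degree_pos_iff_exists_adj]
  refine ⟨Pi.single ⟨0, hd⟩ 1, ?_⟩
  rw [latticeGraph_adj, Finset.sum_eq_single ⟨0, hd⟩]
  · simp
  · intro i _ hi
    simp [hi]
  · simp

/-- The square of the Euclidean distance of two lattice points. -/
def distSq (x y : Fin d → ℤ) : ℕ := ∑ i, (x i - y i).natAbs ^ 2

theorem distSq_cast (x y : Fin d → ℤ) : (distSq x y : ℤ) = ∑ i, (x i - y i) ^ 2 := by
  simp [distSq]

theorem sum_sq_sub_of_adj {x y : Fin d → ℤ} (h : (latticeGraph d).Adj x y) :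
    ∑ i, (x i - y i) ^ 2 = 1 := by
  rw [← latticeGraph_adj.1 h]
  refine Finset.sum_congr rfl fun i _ => ?_
  have h1 : |x i - y i| ≤ 1 := (latticeGraph_adj.1 h) ▸ Finset.single_le_sum
    (f := fun i => |x i - y i|) (fun j _ => abs_nonneg _) (Finset.mem_univ i)
  rw [← sq_abs]
  have h0 := abs_nonneg (x i - y i)
  interval_cases |x i - y i| <;> rfl

/-- The reflection `z ↦ 2x - z` permutes the neighbours of `x`, and the parallelogram law evaluates
each reflected pair. Thus one step raises the mean squared distance by exactly one. -/
theorem sum_neighborFinset_distSq (o x : Fin d → ℤ) :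
    ∑ z ∈ (latticeGraph d).neighborFinset x, distSq z o =
      (latticeGraph d).degree x * (distSq x o + 1) := by
  set N := (latticeGraph d).neighborFinset x
  have hrefl : ∑ z ∈ N, distSq z o = ∑ z ∈ N, distSq (x + x - z) o := by
    have hmem : ∀ z ∈ N, x + x - z ∈ N := fun z hz => by
      simp only [N, SimpleGraph.mem_neighborFinset, latticeGraph_adj] at hz ⊢
      rw [← hz]
      refine Finset.sum_congr rfl fun i _ => ?_
      rw [abs_sub_comm]
      simp only [Pi.sub_apply, Pi.add_apply]
      congr 1
      ring
    exact Finset.sum_nbij' (fun z => x + x - z) (fun z => x + x - z) hmem hmem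
      (by simp) (by simp) (by simp)
  have hpair : ∀ z ∈ N, distSq z o + distSq (x + x - z) o = 2 * (distSq x o + 1) := fun z hz => by
    have h1 := sum_sq_sub_of_adj ((SimpleGraph.mem_neighborFinset _ _ _).1 hz)
    zify
    rw [distSq_cast, distSq_cast, distSq_cast, ← h1, ← Finset.sum_add_distrib,
      ← Finset.sum_add_distrib, Finset.mul_sum]
    refine Finset.sum_congr rfl fun i _ => ?_
    simp only [Pi.sub_apply, Pi.add_apply]
    ring
  have h2 : ∑ z ∈ N, distSq z o + ∑ z ∈ N, distSq z o = N.card * (2 * (distSq x o + 1)) := by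
    nth_rewrite 2 [hrefl]
    rw [← Finset.sum_add_distrib, Finset.sum_congr rfl hpair]
    simp
  have h3 : N.card = (latticeGraph d).degree x := rfl
  rw [h3] at h2
  linarith

theorem tsum_transProb_mul_distSq_le (o : Fin d → ℤ) (n : ℕ) (x : Fin d → ℤ) :
    ∑' y, transProb (latticeGraph d) n x y * (distSq y o : ℝ≥0∞) ≤ distSq x o + n := by
  induction n generalizing x with
  | zero =>
    rw [tsum_eq_single x]
    · simp [transProb]
    · intro y hy
      simp [transProb, hy.symm]
  | succ n ih =>
    simp only [transProb, ← ENNReal.tsum_mul_right]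
    rw [ENNReal.tsum_comm]
    calc _ ≤ ∑' z, stepProb (latticeGraph d) x z * ((distSq z o : ℝ≥0∞) + n) := by
          refine ENNReal.tsum_le_tsum fun z => ?_
          simp only [mul_assoc, ENNReal.tsum_mul_left]
          gcongr
          exact ih z
      _ = ((latticeGraph d).degree x : ℝ≥0∞)⁻¹ *
            ((latticeGraph d).degree x * (distSq x o + 1 + n : ℕ) : ℕ) := by
          rw [tsum_stepProb_mul]
          congr 1
          rw [mul_add, ← sum_neighborFinset_distSq]
          push_cast
          rw [Finset.sum_add_distrib]
          simp
      _ ≤ (distSq x o + 1 + n : ℕ) := by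
          rw [Nat.cast_mul, ← mul_assoc]
          exact mul_le_of_le_one_left' (ENNReal.inv_mul_le_one _)
      _ = _ := by push_cast; ring

theorem inv_two_le_sum_box_transProb (hd : 0 < d) (o : Fin d → ℤ) (n : ℕ) :
    (2 : ℝ≥0∞)⁻¹ ≤ ∑ y ∈ Finset.Icc (fun i => o i - (Nat.sqrt (2 * n) : ℤ))
      (fun i => o i + (Nat.sqrt (2 * n) : ℤ)), transProb (latticeGraph d) n o y := by
  classical
  set r := Nat.sqrt (2 * n)
  set B := Finset.Icc (fun i => o i - (r : ℤ)) (fun i => o i + (r : ℤ))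
  set p := transProb (latticeGraph d) n o
  have hp1 : ∑' y, p y = 1 := tsum_transProb (latticeGraph_isRegularOfDegree d)
    (latticeGraph_degree_ne_zero hd 0) n o
  have hout : ∀ y ∉ B, 2 * n < distSq y o := fun y hy => by
    obtain ⟨i, hi⟩ : ∃ i, r + 1 ≤ (y i - o i).natAbs := by
      by_contra! hcon
      refine hy (Finset.mem_Icc.2 ⟨fun i => ?_, fun i => ?_⟩) <;>
      · have := hcon i
        dsimp only
        omega
    calc 2 * n < (r + 1) * (r + 1) := Nat.lt_succ_sqrt _
      _ ≤ (y i - o i).natAbs ^ 2 := by rw [sq]; exact Nat.mul_le_mul hi hi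
      _ ≤ _ := Finset.single_le_sum (f := fun i => (y i - o i).natAbs ^ 2)
          (fun _ _ => Nat.zero_le _) (Finset.mem_univ i)
  -- Markov's inequality at the integer threshold `2 * n + 1`, which stays positive at `n = 0`; the
  -- outside mass is at most `n / (2 * n + 1) ≤ 1 / 2`.
  have hn : (2 * n + 1 : ℕ) * ∑' y, (if y ∈ B then 0 else p y) ≤ n := by
    rw [← ENNReal.tsum_mul_left]
    calc _ ≤ ∑' y, p y * (distSq y o : ℝ≥0∞) := by
          refine ENNReal.tsum_le_tsum fun y => ?_
          split_ifs with hy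
          · simp
          · rw [mul_comm]
            gcongr
            exact hout y hy
      _ ≤ (distSq o o : ℝ≥0∞) + n := tsum_transProb_mul_distSq_le o n o
      _ = n := by simp [distSq]
  have hsplit : ∑ y ∈ B, p y + ∑' y, (if y ∈ B then 0 else p y) = 1 := by
    have hin : ∑ y ∈ B, p y = ∑' y, (if y ∈ B then p y else 0) := by
      rw [tsum_eq_sum (s := B) fun y hy => if_neg hy]
      exact Finset.sum_congr rfl fun y hy => (if_pos hy).symm
    rw [← hp1, hin, ← ENNReal.tsum_add]
    refine tsum_congr fun y => ?_
    by_cases hy : y ∈ B <;> simp [hy]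
  generalize ∑ y ∈ B, p y = a at hsplit ⊢
  generalize ∑' y, (if y ∈ B then 0 else p y) = b at hsplit hn
  have ha : a ≠ ∞ := ne_top_of_le_ne_top ENNReal.one_ne_top (hsplit ▸ le_self_add)
  have hb : b ≠ ∞ := ne_top_of_le_ne_top ENNReal.one_ne_top (hsplit ▸ le_add_self)
  lift a to NNReal using ha
  lift b to NNReal using hb
  have hn' : ((2 * n + 1 : ℕ) : NNReal) * b ≤ n := by exact_mod_cast hn
  have hs' : a + b = 1 := by exact_mod_cast hsplit
  have h1 : (2 * n + 1 : ℝ) * b ≤ n := by exact_mod_cast hn'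
  have h2 : (a + b : ℝ) = 1 := by exact_mod_cast hs'
  have h3 : (2⁻¹ : ℝ) ≤ a := by
    have : (0 : ℝ) ≤ n := n.cast_nonneg
    have hb0 : (0 : ℝ) ≤ b := b.2
    nlinarith
  have h4 : (2⁻¹ : NNReal) ≤ a := by exact_mod_cast h3
  have h5 : ((2⁻¹ : NNReal) : ℝ≥0∞) ≤ a := by exact_mod_cast h4
  simpa using h5

theorem le_transProb_self (hd : 0 < d) (o : Fin d → ℤ) (n : ℕ) :
    ENNReal.ofReal (1 / (4 * (2 * Nat.sqrt (2 * n) + 1) ^ d)) ≤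
      transProb (latticeGraph d) (n + n) o o := by
  convert inv_le_transProb_self (latticeGraph_isRegularOfDegree d) n o _
    (inv_two_le_sum_box_transProb hd o n) using 4
  have : ∀ i, (Finset.Icc (o i - (Nat.sqrt (2 * n) : ℤ)) (o i + Nat.sqrt (2 * n))).card =
      2 * Nat.sqrt (2 * n) + 1 := fun i => by
    rw [Int.card_Icc]
    omega
  rw [Pi.card_Icc, Finset.prod_congr rfl fun i _ => this i]
  simp

/-- Only even times are kept; `(k + 1) / 2` of them lie below `k`. -/
theorem le_sum_transProb_self (hd : 0 < d) (o : Fin d → ℤ) (k : ℕ) :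
    ENNReal.ofReal (∑ n ∈ Finset.range ((k + 1) / 2),
      1 / (4 * (2 * Nat.sqrt (2 * n) + 1 : ℝ) ^ d)) ≤
      ∑ n ∈ Finset.range k, transProb (latticeGraph d) n o o := by
  rw [ENNReal.ofReal_sum_of_nonneg fun n _ => by positivity]
  refine (Finset.sum_le_sum fun n _ => le_transProb_self hd o n).trans ?_
  rw [← Finset.sum_image (s := Finset.range ((k + 1) / 2)) (g := fun n => n + n)
    (f := fun n => transProb (latticeGraph d) n o o)
    (fun a _ b _ h => by dsimp only at h; omega)]
  refine Finset.sum_le_sum_of_subset fun m hm => ?_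
  simp only [Finset.mem_image, Finset.mem_range] at hm ⊢
  obtain ⟨a, ha, rfl⟩ := hm
  omega

theorem tsum_hitProb_le_of_le (hd : 0 < d) (o : Fin d → ℤ) {k : ℕ} {g c f : ℝ}
    (hg : 0 < g) (hgle : g ≤ ∑ n ∈ Finset.range ((k + 1) / 2),
      1 / (4 * (2 * Nat.sqrt (2 * n) + 1 : ℝ) ^ d)) (hc : 0 ≤ c) (hf : 2 * k ≤ c * f * g) :
    ∑' x, hitProb (latticeGraph d) o k x ≤ ENNReal.ofReal c * ENNReal.ofReal f := by
  have h := tsum_hitProb_mul_le (latticeGraph_isRegularOfDegree d) o k k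
  have hG := (ENNReal.ofReal_le_ofReal hgle).trans (le_sum_transProb_self hd o k)
  have h1 : (∑' x, hitProb (latticeGraph d) o k x) * ENNReal.ofReal g ≤
      (ENNReal.ofReal c * ENNReal.ofReal f) * ENNReal.ofReal g := by
    refine (mul_le_mul_right hG _).trans (h.trans ?_)
    rw [← ENNReal.ofReal_mul hc, ← ENNReal.ofReal_mul' hg.le, ← ENNReal.ofReal_natCast]
    refine ENNReal.ofReal_le_ofReal (le_trans (le_of_eq ?_) hf)
    push_cast
    ring
  exact (ENNReal.mul_le_mul_iff_left (by simpa using hg) ENNReal.ofReal_ne_top).1 h1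

theorem tsum_hitProb_latticeGraph_one_le (o : Fin 1 → ℤ) (k : ℕ) :
    ∑' x, hitProb (latticeGraph 1) o k x ≤
      ENNReal.ofReal 48 * ENNReal.ofReal (Real.sqrt k) := by
  rcases k.eq_zero_or_pos with rfl | hk
  · simp [hitProb]
  have hk1 : (1 : ℝ) ≤ k := by exact_mod_cast hk
  have hs1 : 1 ≤ Real.sqrt k := Real.one_le_sqrt.2 hk1
  have hss : Real.sqrt k * Real.sqrt k = k := Real.mul_self_sqrt (by positivity)
  -- At least `k / 2` terms, each at least `1 / (12 * √k)`, sum to `√k / 24`; then `48 = 2 * 24`.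
  refine tsum_hitProb_le_of_le one_pos o (g := Real.sqrt k / 24) (by positivity) ?_ (by norm_num)
    (by nlinarith)
  have hterm : ∀ n ∈ Finset.range ((k + 1) / 2),
      1 / (12 * Real.sqrt k) ≤ 1 / (4 * (2 * Nat.sqrt (2 * n) + 1 : ℝ) ^ 1) := fun n hn => by
    rw [Finset.mem_range] at hn
    have h1 : (Nat.sqrt (2 * n) : ℝ) ≤ Real.sqrt k := by
      refine Real.le_sqrt_of_sq_le ?_
      have : Nat.sqrt (2 * n) ^ 2 ≤ k := (Nat.sqrt_le' _).trans (by omega)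
      exact_mod_cast this
    apply one_div_le_one_div_of_le (by positivity)
    linarith
  refine le_trans ?_ (Finset.card_nsmul_le_sum _ _ _ hterm)
  have h2 : (k : ℝ) ≤ 2 * ((k + 1) / 2 : ℕ) := by
    have : k ≤ 2 * ((k + 1) / 2) := by omega
    exact_mod_cast this
  rw [Finset.card_range, nsmul_eq_mul, mul_one_div, div_le_div_iff₀ (by norm_num) (by positivity)]
  nlinarith

theorem tsum_hitProb_latticeGraph_two_le (o : Fin 2 → ℤ) (k : ℕ) :
    ∑' x, hitProb (latticeGraph 2) o k x ≤
      ENNReal.ofReal 256 * ENNReal.ofReal (k / Real.log (max (k : ℝ) 2)) := by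
  rcases k.eq_zero_or_pos with rfl | hk
  · simp [hitProb]
  have hk1 : (1 : ℝ) ≤ k := by exact_mod_cast hk
  have hm : (2 : ℝ) ≤ max (k : ℝ) 2 := le_max_right _ _
  have hl : 0 < Real.log (max (k : ℝ) 2) := Real.log_pos (by linarith)
  -- The terms dominate `1 / 64` of a harmonic sum, and `hlog` costs a further factor 2; then `256 =
  -- 2 * 128`.
  refine tsum_hitProb_le_of_le two_pos o (g := Real.log (max (k : ℝ) 2) / 128) (by positivity) ?_
    (by norm_num) (le_of_eq (by field_simp; norm_num))
  have hterm : ∀ n ∈ Finset.range ((k + 1) / 2),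
      1 / 64 * ((n + 1 : ℕ) : ℝ)⁻¹ ≤ 1 / (4 * (2 * Nat.sqrt (2 * n) + 1 : ℝ) ^ 2) := fun n _ => by
    have h1 : (Nat.sqrt (2 * n) : ℝ) ^ 2 ≤ 2 * n := by exact_mod_cast Nat.sqrt_le' (2 * n)
    rw [one_div_mul_eq_div, ← one_div, div_div]
    apply one_div_le_one_div_of_le (by positivity)
    push_cast
    nlinarith [sq_nonneg (2 * (Nat.sqrt (2 * n) : ℝ) - 1)]
  refine le_trans ?_ (Finset.sum_le_sum hterm)
  rw [← Finset.mul_sum]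
  have hharm := log_add_one_le_harmonic ((k + 1) / 2)
  have hcast : (harmonic ((k + 1) / 2) : ℝ) =
      ∑ n ∈ Finset.range ((k + 1) / 2), ((n + 1 : ℕ) : ℝ)⁻¹ := by
    simp [harmonic]
  rw [hcast, Nat.cast_add_one] at hharm
  have h2 : (k : ℝ) ≤ 2 * ((k + 1) / 2 : ℕ) := by
    have : k ≤ 2 * ((k + 1) / 2) := by omega
    exact_mod_cast this
  -- With `N = (k + 1) / 2`, both `k` and `2` are at most `(N + 1) ^ 2`.
  have hlog : Real.log (max (k : ℝ) 2) ≤ 2 * Real.log (((k + 1) / 2 : ℕ) + 1) := by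
    rw [show (2 : ℝ) = (2 : ℕ) by norm_num, ← Real.log_pow]
    refine Real.log_le_log (by positivity) (max_le ?_ ?_)
    · nlinarith
    · push_cast
      nlinarith
  linarith

end Lattice

end Frog

theorem theorem2p13 (μ : Measure ℕ) [IsProbabilityMeasure μ] :
    ((∫⁻ k, ENNReal.ofReal (Real.sqrt (k : ℝ)) ∂μ < ∞) →
      ∀ o : Fin 1 → ℤ, Frog.Transient.{0, w} (latticeGraph 1) o μ) ∧
    ((∫⁻ k, ENNReal.ofReal ((k : ℝ) / Real.log (max (k : ℝ) 2)) ∂μ < ∞) →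
      ∀ o : Fin 2 → ℤ, Frog.Transient.{0, w} (latticeGraph 2) o μ) ∧
    ((∫⁻ k, (k : ℝ≥0∞) ∂μ < ∞) → ∀ d : ℕ, 3 ≤ d →
      (∀ (V : Type u) [MeasurableSpace V] [DiscreteMeasurableSpace V]
        (G : SimpleGraph V) [G.LocallyFinite],
        G.IsTree → G.IsRegularOfDegree d → ∀ o : V, Frog.Transient.{u, w} G o μ) ∧
      (∀ o : Fin d → ℤ, Frog.Transient.{0, w} (latticeGraph d) o μ)) := by
  refine ⟨fun hμ o => ?_, fun hμ o => ?_, fun hμ d _ => ⟨fun V _ _ G _ hT hG o => ?_, fun o => ?_⟩⟩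
  · exact Frog.transient_of_tsum_hitProb_le o ENNReal.ofReal_ne_top
      (Frog.tsum_hitProb_latticeGraph_one_le o) hμ
  · exact Frog.transient_of_tsum_hitProb_le o ENNReal.ofReal_ne_top
      (Frog.tsum_hitProb_latticeGraph_two_le o) hμ
  · have := Frog.countable_of_preconnected G hT.connected.preconnected o
    exact Frog.transient_of_isRegularOfDegree hG o hμ
  · exact Frog.transient_of_isRegularOfDegree (Frog.latticeGraph_isRegularOfDegree d) o hμ
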